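/- Let $\mathcal{C}$ be a (possibly non-unital) $C^*$-algebra, let $\mathcal{D}$ be a nonzero commutative (possibly non-unital) $C^*$-algebra, and let $\mathcal{A}$ and $\mathcal{B}$ be finite-dimensional $*$-subalgebras of $\mathcal{C}$. Then \[ d_{KK}(\mathcal{A}, \mathcal{B}) = d_{KK}(\mathcal{A} \otimes^{\min} \mathcal{D}, \mathcal{B}\otimes^{\min} \mathcal{D}) \quad\text{and}\quad d_0(\mathcal{A}, \mathcal{B}) = d_0(\mathcal{A} \otimes^{\min} \mathcal{D}, \mathcal{B}\otimes^{\min} \mathcal{D}). \] Here $\mathcal{C}\otimes^{\min}\mathcal{D}$ is the completion of the algebraic tensor product $\mathcal{C}\otimes\mathcal{D}$ in the minimal $C^*$-norm \[ \|z\|_{\min} = \sup\left\{ \left(\frac{(\varphi\otimes\psi)(w^*z^*zw)}{(\varphi\otimes\psi)(w^*w)}\right)^{1/2} : \varphi, \psi \text{ states of } \mathcal{C}, \mathcal{D},\ w\in\mathcal{C}\otimes\mathcal{D},\ (\varphi\otimes\psi)(w^*w)\neq 0\right\}, \] and $\mathcal{A}\otimes^{\min}\mathcal{D}$, $\mathcal{B}\otimes^{\min}\mathcal{D}$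 are regarded as the closures of $\mathcal{A}\otimes\mathcal{D}$, $\mathcal{B}\otimes\mathcal{D}$ in $\mathcal{C}\otimes^{\min}\mathcal{D}$. For subspaces $\mathcal{X},\mathcal{Y}$ of a normed space, with closed unit balls $B_1(\mathcal{X}), B_1(\mathcal{Y})$, the Kadison--Kastler distance is \[ d_{KK}(\mathcal{X},\mathcal{Y}) = \max\Big\{\sup_{x\in B_1(\mathcal{X})} d(x,B_1(\mathcal{Y})),\ \sup_{y\in B_1(\mathcal{Y})} d(y,B_1(\mathcal{X}))\Big\}, \] and the Christensen distance is $d_0(\mathcal{X},\mathcal{Y}) = \inf\{\gamma>0 : \mathcal{X}\subseteq_\gamma\mathcal{Y} \text{ and } \mathcal{Y}\subseteq_\gamma\mathcal{X}\}$, where $\mathcal{X}\subseteq_\gamma\mathcal{Y}$ means that for every $x\in B_1(\mathcal{X})$ there is $y\in\mathcal{Y}$ with $\|x-y\|\le\gamma$. -/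

import Mathlib

open scoped TensorProduct ComplexOrder

noncomputable section

namespace MinTensor

/-! ### States -/

/-- The state space of a (possibly non-unital) C⋆-algebra: the positive linear functionals of
norm one. -/
def stateSpace (C : Type*) [NonUnitalCStarAlgebra C] : Set (StrongDual ℂ C) :=
  {φ | (∀ a : C, 0 ≤ φ (star a * a)) ∧ ‖φ‖ = 1}

section Functional

variable {C D : Type*} [NonUnitalCStarAlgebra C] [NonUnitalCStarAlgebra D]

/-- The functional `φ ⊗ ψ` on the algebraic tensor product, `c ⊗ d ↦ φ c * ψ d`. -/
def tensorFunctional (φ : StrongDual ℂ C) (ψ : StrongDual ℂ D) : C ⊗[ℂ] D →ₗ[ℂ] ℂ :=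
  (TensorProduct.lid ℂ ℂ).toLinearMap ∘ₗ TensorProduct.map φ.toLinearMap ψ.toLinearMap

@[simp] lemma tensorFunctional_tmul (φ : StrongDual ℂ C) (ψ : StrongDual ℂ D) (c : C) (d : D) :
    tensorFunctional φ ψ (c ⊗ₜ d) = φ c * ψ d := by
  simp [tensorFunctional]

/-- The minimal C⋆-norm of an element `z` of the algebraic tensor product:
the supremum of `((φ ⊗ ψ)(w⋆ z⋆ z w) / (φ ⊗ ψ)(w⋆ w)) ^ (1/2)` over all states `φ`, `ψ` and
all `w` with `(φ ⊗ ψ)(w⋆ w) ≠ 0`. (All values `(φ ⊗ ψ)(u⋆ u)` are real and nonnegative.) -/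
def minNorm (z : C ⊗[ℂ] D) : ℝ :=
  sSup {r : ℝ | ∃ φ ∈ stateSpace C, ∃ ψ ∈ stateSpace D, ∃ w : C ⊗[ℂ] D,
    tensorFunctional φ ψ (star w * w) ≠ 0 ∧
    r = √((tensorFunctional φ ψ (star w * star z * z * w)).re /
          (tensorFunctional φ ψ (star w * w)).re)}

/-! ### `minNorm` is a seminorm -/

lemma map_star_of_mem {φ : StrongDual ℂ C} (hφ : φ ∈ stateSpace C) (a : C) :
    φ (star a) = star (φ a) := by
  let _ : PartialOrder C := CStarAlgebra.spectralOrder C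
  let _ : StarOrderedRing C := CStarAlgebra.spectralOrderedRing C
  let f : C →ₚ[ℂ] ℂ := PositiveLinearMap.mk₀ φ.toLinearMap (by
    intro x hx
    obtain ⟨b, rfl⟩ := CStarAlgebra.nonneg_iff_eq_star_mul_self.mp hx
    exact hφ.1 b)
  exact map_star f a

lemma left_mul_le {φ : StrongDual ℂ C} (hφ : φ ∈ stateSpace C) (c x : C) :
    φ (star (c * x) * (c * x)) ≤ (‖c‖ ^ 2 : ℝ) * φ (star x * x) := by
  let _ : PartialOrder C := CStarAlgebra.spectralOrder C
  let _ : StarOrderedRing C := CStarAlgebra.spectralOrderedRing C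
  have h : star x * (star c * c) * x ≤ ‖star c * c‖ • (star x * x) :=
    CStarAlgebra.star_left_conjugate_le_norm_smul
  rw [CStarRing.norm_star_mul_self, ← sub_nonneg] at h
  obtain ⟨b, hb⟩ := CStarAlgebra.nonneg_iff_eq_star_mul_self.mp h
  have h2 := hφ.1 b
  rw [← hb, map_sub, sub_nonneg] at h2
  have e : star (c * x) * (c * x) = star x * (star c * c) * x := by
    simp [mul_assoc]
  rw [e]
  refine h2.trans_eq ?_
  rw [← Complex.coe_smul, map_smul, smul_eq_mul, sq]

lemma posSemidef_form {φ : StrongDual ℂ C} (hφ : φ ∈ stateSpace C) :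
    (Matrix.of fun x y : C ↦ φ (star x * y)).PosSemidef := by
  refine ⟨?_, fun x ↦ ?_⟩
  · ext a b
    simp [Matrix.conjTranspose_apply, ← map_star_of_mem hφ]
  · have := hφ.1 (x.sum fun a t ↦ t • a)
    refine this.trans_eq ?_
    simp only [Finsupp.sum, star_sum, star_smul, Finset.sum_mul, Finset.mul_sum, map_sum,
      smul_mul_assoc, mul_smul_comm, map_smul, smul_eq_mul, Matrix.of_apply]
    conv_lhs => rw [Finset.sum_comm]
    refine Finset.sum_congr rfl fun a _ ↦ Finset.sum_congr rfl fun b _ ↦ ?_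
    ring

lemma posSemidef_form_mul {φ : StrongDual ℂ C} (hφ : φ ∈ stateSpace C) (c : C) :
    (Matrix.of fun x y : C ↦ φ (star (c * x) * (c * y))).PosSemidef :=
  (posSemidef_form hφ).submatrix fun x ↦ c * x

lemma posSemidef_form_sub {φ : StrongDual ℂ C} (hφ : φ ∈ stateSpace C) (c : C) :
    (Matrix.of fun x y : C ↦ (‖c‖ ^ 2 : ℝ) * φ (star x * y) -
      φ (star (c * x) * (c * y))).PosSemidef := by
  refine ⟨?_, fun x ↦ ?_⟩
  · ext a b
    simp only [Matrix.conjTranspose_apply, Matrix.of_apply, star_sub, ← map_star_of_mem hφ,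
      star_mul, star_star, mul_assoc]
    simp [mul_comm]
  · have := sub_nonneg.mpr (left_mul_le hφ c (x.sum fun a t ↦ t • a))
    refine this.trans_eq ?_
    simp only [Finsupp.sum, star_sum, star_smul, Finset.sum_mul, Finset.mul_sum, map_sum,
      smul_mul_assoc, mul_smul_comm, map_smul, smul_eq_mul, Matrix.of_apply,
      ← Finset.sum_sub_distrib]
    conv_lhs => rw [Finset.sum_comm]
    refine Finset.sum_congr rfl fun a _ ↦ Finset.sum_congr rfl fun b _ ↦ ?_
    ring

lemma sum_mul_nonneg {ι κ : Type*} {M : Matrix ι ι ℂ} {N : Matrix κ κ ℂ} (hM : M.PosSemidef)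
    (hN : N.PosSemidef) (S : Finset (ι × κ)) :
    0 ≤ ∑ i ∈ S, ∑ j ∈ S, M i.1 j.1 * N i.2 j.2 := by
  have h := ((hM.submatrix fun i : S ↦ i.1.1).hadamard
    (hN.submatrix fun i : S ↦ i.1.2)).dotProduct_mulVec_nonneg (fun _ ↦ 1)
  refine h.trans_eq ?_
  rw [← Finset.sum_coe_sort S]
  simp only [dotProduct, Matrix.mulVec, Pi.star_apply, star_one, one_mul, mul_one,
    Matrix.hadamard_apply, Matrix.submatrix_apply]
  refine Finset.sum_congr rfl fun a _ ↦ ?_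
  rw [← Finset.sum_coe_sort S]

lemma tensorFunctional_sum (φ : StrongDual ℂ C) (ψ : StrongDual ℂ D) (S : Finset (C × D)) :
    tensorFunctional φ ψ (star (∑ i ∈ S, i.1 ⊗ₜ[ℂ] i.2) * ∑ i ∈ S, i.1 ⊗ₜ[ℂ] i.2) =
      ∑ i ∈ S, ∑ j ∈ S, φ (star i.1 * j.1) * ψ (star i.2 * j.2) := by
  simp [star_sum, Finset.sum_mul_sum]

lemma tensorFunctional_nonneg {φ : StrongDual ℂ C} {ψ : StrongDual ℂ D}
    (hφ : φ ∈ stateSpace C) (hψ : ψ ∈ stateSpace D) (w : C ⊗[ℂ] D) :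
    0 ≤ tensorFunctional φ ψ (star w * w) := by
  obtain ⟨S, rfl⟩ := TensorProduct.exists_finset w
  rw [tensorFunctional_sum]
  exact sum_mul_nonneg (posSemidef_form hφ) (posSemidef_form hψ) S

lemma tensorFunctional_star {φ : StrongDual ℂ C} {ψ : StrongDual ℂ D}
    (hφ : φ ∈ stateSpace C) (hψ : ψ ∈ stateSpace D) (w : C ⊗[ℂ] D) :
    tensorFunctional φ ψ (star w) = star (tensorFunctional φ ψ w) := by
  induction w with
  | zero => simp
  | tmul c d => simp [map_star_of_mem hφ, map_star_of_mem hψ]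
  | add x y hx hy => simp only [star_add, map_add, hx, hy]

lemma tensorFunctional_mul_le {φ : StrongDual ℂ C} {ψ : StrongDual ℂ D}
    (hφ : φ ∈ stateSpace C) (hψ : ψ ∈ stateSpace D) (c : C) (d : D) (w : C ⊗[ℂ] D) :
    tensorFunctional φ ψ (star (c ⊗ₜ d * w) * (c ⊗ₜ d * w)) ≤
      ((‖c‖ * ‖d‖) ^ 2 : ℝ) * tensorFunctional φ ψ (star w * w) := by
  obtain ⟨S, rfl⟩ := TensorProduct.exists_finset w
  have h1 := sum_mul_nonneg (posSemidef_form_sub hφ c) (posSemidef_form_mul hψ d) S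
  have h2 := sum_mul_nonneg (posSemidef_form hφ) (posSemidef_form_sub hψ d) S
  have h3 := add_nonneg h1 (mul_nonneg (a := ((‖c‖ ^ 2 : ℝ) : ℂ))
    (by exact_mod_cast sq_nonneg ‖c‖) h2)
  rw [← sub_nonneg]
  refine h3.trans_eq ?_
  rw [tensorFunctional_sum, Finset.mul_sum (a := c ⊗ₜ[ℂ] d), star_sum, Finset.sum_mul_sum]
  simp only [Algebra.TensorProduct.tmul_mul_tmul, Finset.mul_sum,
    TensorProduct.star_tmul, map_sum, tensorFunctional_tmul, Matrix.of_apply]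
  simp only [← Finset.sum_sub_distrib, ← Finset.sum_add_distrib]
  refine Finset.sum_congr rfl fun a _ ↦ Finset.sum_congr rfl fun b _ ↦ ?_
  push_cast
  ring

/-- The semi-inner product `⟪u, v⟫ = (φ ⊗ ψ)(u⋆ v)`. -/
abbrev preCore {φ : StrongDual ℂ C} {ψ : StrongDual ℂ D}
    (hφ : φ ∈ stateSpace C) (hψ : ψ ∈ stateSpace D) :
    PreInnerProductSpace.Core ℂ (C ⊗[ℂ] D) where
  inner u v := tensorFunctional φ ψ (star u * v)
  conj_inner_symm u v := by
    rw [← Complex.star_def, ← tensorFunctional_star hφ hψ]; simp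
  re_inner_nonneg u := (RCLike.nonneg_iff.mp (tensorFunctional_nonneg hφ hψ u)).1
  add_left u v w := by simp [add_mul]
  smul_left u v r := by rw [star_smul, smul_mul_assoc, map_smul, smul_eq_mul]; rfl

lemma exists_seminorm {φ : StrongDual ℂ C} {ψ : StrongDual ℂ D}
    (hφ : φ ∈ stateSpace C) (hψ : ψ ∈ stateSpace D) :
    ∃ p : Seminorm ℂ (C ⊗[ℂ] D),
      ∀ u, p u = √(tensorFunctional φ ψ (star u * u)).re := by
  let c := preCore hφ hψ
  let _ : SeminormedAddCommGroup (C ⊗[ℂ] D) :=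
    InnerProductSpace.Core.toSeminormedAddCommGroup (c := c)
  let _ : InnerProductSpace ℂ (C ⊗[ℂ] D) := InnerProductSpace.ofCore c
  exact ⟨normSeminorm ℂ (C ⊗[ℂ] D), fun u ↦ rfl⟩

/-- A bound for the supremum defining `minNorm z`. -/
lemma exists_bound (z : C ⊗[ℂ] D) : ∃ K : ℝ, ∀ φ ∈ stateSpace C, ∀ ψ ∈ stateSpace D,
    ∀ w : C ⊗[ℂ] D, √(tensorFunctional φ ψ (star (z * w) * (z * w))).re ≤
      K * √(tensorFunctional φ ψ (star w * w)).re := by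
  induction z with
  | zero => exact ⟨0, by simp⟩
  | tmul c d =>
    refine ⟨‖c‖ * ‖d‖, fun φ hφ ψ hψ w ↦ ?_⟩
    have h := (Complex.le_def.mp (tensorFunctional_mul_le hφ hψ c d w)).1
    rw [Complex.re_ofReal_mul] at h
    refine (Real.sqrt_le_sqrt h).trans_eq ?_
    rw [Real.sqrt_mul (sq_nonneg _), Real.sqrt_sq (by positivity)]
  | add x y hx hy =>
    obtain ⟨K, hK⟩ := hx
    obtain ⟨L, hL⟩ := hy
    refine ⟨K + L, fun φ hφ ψ hψ w ↦ ?_⟩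
    obtain ⟨p, hp⟩ := exists_seminorm hφ hψ
    have h1 := hK φ hφ ψ hψ w
    have h2 := hL φ hφ ψ hψ w
    simp only [← hp] at h1 h2 ⊢
    rw [add_mul, add_mul]
    exact (map_add_le_add p _ _).trans (add_le_add h1 h2)

lemma ratio_eq (φ : StrongDual ℂ C) (ψ : StrongDual ℂ D) (z w : C ⊗[ℂ] D)
    (h : 0 ≤ (tensorFunctional φ ψ (star (z * w) * (z * w))).re) :
    √((tensorFunctional φ ψ (star w * star z * z * w)).re /
      (tensorFunctional φ ψ (star w * w)).re) =
    √(tensorFunctional φ ψ (star (z * w) * (z * w))).re /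
      √(tensorFunctional φ ψ (star w * w)).re := by
  rw [← Real.sqrt_div h]
  simp [mul_assoc]

lemma minNorm_nonneg (z : C ⊗[ℂ] D) : 0 ≤ minNorm z := by
  apply Real.sSup_nonneg
  rintro r ⟨φ, -, ψ, -, w, -, rfl⟩
  exact Real.sqrt_nonneg _

lemma re_nonneg {φ : StrongDual ℂ C} {ψ : StrongDual ℂ D}
    (hφ : φ ∈ stateSpace C) (hψ : ψ ∈ stateSpace D) (w : C ⊗[ℂ] D) :
    0 ≤ (tensorFunctional φ ψ (star w * w)).re :=
  (Complex.le_def.mp (tensorFunctional_nonneg hφ hψ w)).1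

lemma re_pos {φ : StrongDual ℂ C} {ψ : StrongDual ℂ D}
    (hφ : φ ∈ stateSpace C) (hψ : ψ ∈ stateSpace D) {w : C ⊗[ℂ] D}
    (hw : tensorFunctional φ ψ (star w * w) ≠ 0) :
    0 < (tensorFunctional φ ψ (star w * w)).re :=
  (Complex.lt_def.mp ((tensorFunctional_nonneg hφ hψ w).lt_of_ne' hw)).1

lemma sqrt_le_minNorm_mul {φ : StrongDual ℂ C} {ψ : StrongDual ℂ D}
    (hφ : φ ∈ stateSpace C) (hψ : ψ ∈ stateSpace D) (z w : C ⊗[ℂ] D) :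
    √(tensorFunctional φ ψ (star (z * w) * (z * w))).re ≤
      minNorm z * √(tensorFunctional φ ψ (star w * w)).re := by
  obtain ⟨K, hK⟩ := exists_bound z
  by_cases hw : tensorFunctional φ ψ (star w * w) = 0
  · simpa [hw] using hK φ hφ ψ hψ w
  · have hpos := Real.sqrt_pos.mpr (re_pos hφ hψ hw)
    rw [← div_le_iff₀ hpos, ← ratio_eq φ ψ z w (re_nonneg hφ hψ _)]
    refine le_csSup ⟨K, ?_⟩ ⟨φ, hφ, ψ, hψ, w, hw, rfl⟩
    rintro r ⟨φ, hφ, ψ, hψ, w, hw, rfl⟩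
    rw [ratio_eq φ ψ z w (re_nonneg hφ hψ _),
      div_le_iff₀ (Real.sqrt_pos.mpr (re_pos hφ hψ hw))]
    exact hK φ hφ ψ hψ w

lemma minNorm_le {z : C ⊗[ℂ] D} {K : ℝ} (hK : 0 ≤ K)
    (h : ∀ φ ∈ stateSpace C, ∀ ψ ∈ stateSpace D,
    ∀ w : C ⊗[ℂ] D, √(tensorFunctional φ ψ (star (z * w) * (z * w))).re ≤
      K * √(tensorFunctional φ ψ (star w * w)).re) : minNorm z ≤ K := by
  refine Real.sSup_le ?_ hK
  rintro r ⟨φ, hφ, ψ, hψ, w, hw, rfl⟩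
  rw [ratio_eq φ ψ z w (re_nonneg hφ hψ _),
    div_le_iff₀ (Real.sqrt_pos.mpr (re_pos hφ hψ hw))]
  exact h φ hφ ψ hψ w

variable (C D) in
/-- `minNorm`, bundled as a seminorm. -/
def minSeminorm : Seminorm ℂ (C ⊗[ℂ] D) :=
  Seminorm.ofSMulLE minNorm
    (le_antisymm (minNorm_le le_rfl fun φ _ ψ _ w ↦ by simp) (minNorm_nonneg _))
    (fun x y ↦ minNorm_le (add_nonneg (minNorm_nonneg x) (minNorm_nonneg y))
      fun φ hφ ψ hψ w ↦ by
        obtain ⟨p, hp⟩ := exists_seminorm hφ hψ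
        have h1 := sqrt_le_minNorm_mul hφ hψ x w
        have h2 := sqrt_le_minNorm_mul hφ hψ y w
        simp only [← hp] at h1 h2 ⊢
        rw [add_mul, add_mul]
        exact (map_add_le_add p _ _).trans (add_le_add h1 h2))
    (fun r x ↦ minNorm_le (mul_nonneg (norm_nonneg r) (minNorm_nonneg x))
      fun φ hφ ψ hψ w ↦ by
        obtain ⟨p, hp⟩ := exists_seminorm hφ hψ
        have h1 := sqrt_le_minNorm_mul hφ hψ x w
        simp only [← hp] at h1 ⊢
        rw [smul_mul_assoc, map_smul_eq_mul, mul_assoc]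
        gcongr)

end Functional

/-! ### The completion -/

/-- The algebraic tensor product, as a type carrying the minimal C⋆-norm. -/
def AlgTensor (C D : Type*) [NonUnitalCStarAlgebra C] [NonUnitalCStarAlgebra D] : Type _ :=
  C ⊗[ℂ] D

variable (C D : Type*) [NonUnitalCStarAlgebra C] [NonUnitalCStarAlgebra D]

instance : AddCommGroup (AlgTensor C D) := inferInstanceAs (AddCommGroup (C ⊗[ℂ] D))

instance : Module ℂ (AlgTensor C D) := inferInstanceAs (Module ℂ (C ⊗[ℂ] D))

/-- The identity map from the algebraic tensor product to its normed version. -/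
def toAlgTensor : C ⊗[ℂ] D ≃ₗ[ℂ] AlgTensor C D := LinearEquiv.refl ℂ (C ⊗[ℂ] D)

instance : SeminormedAddCommGroup (AlgTensor C D) :=
  AddGroupSeminorm.toSeminormedAddCommGroup
    ((minSeminorm C D).comp (toAlgTensor C D).symm.toLinearMap).toAddGroupSeminorm

instance : NormedSpace ℂ (AlgTensor C D) where
  __ := (inferInstance : Module ℂ (AlgTensor C D))
  norm_smul_le r x :=
    (map_smul_eq_mul ((minSeminorm C D).comp (toAlgTensor C D).symm.toLinearMap) r x).le

/-- The norm of `AlgTensor C D` is the minimal C⋆-norm. -/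
lemma norm_toAlgTensor (z : C ⊗[ℂ] D) : ‖toAlgTensor C D z‖ = minNorm z := rfl

/-- The (Banach space underlying the) minimal tensor product `C ⊗ᵐⁱⁿ D`: the completion of
`C ⊗ D` in the minimal C⋆-norm. -/
abbrev MinTensorProduct : Type _ := UniformSpace.Completion (AlgTensor C D)

/-- The canonical map from the algebraic to the minimal tensor product. -/
def incl : C ⊗[ℂ] D →ₗ[ℂ] MinTensorProduct C D :=
  (UniformSpace.Completion.toComplL (𝕜 := ℂ) (E := AlgTensor C D)).toLinearMap ∘ₗ
    (toAlgTensor C D).toLinearMap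

variable {C}

/-- The underlying linear subspace of a ⋆-subalgebra. -/
abbrev toSubspace (A : NonUnitalStarSubalgebra ℂ C) : Submodule ℂ C :=
  A.toNonUnitalSubalgebra.toSubmodule

/-- `A ⊗ᵐⁱⁿ D` as a closed subspace of `C ⊗ᵐⁱⁿ D`: the closure of the span of the elementary
tensors `a ⊗ d` with `a ∈ A` and `d ∈ D`. -/
def subTensor (A : NonUnitalStarSubalgebra ℂ C) : Submodule ℂ (MinTensorProduct C D) :=
  (Submodule.span ℂ {x | ∃ a ∈ A, ∃ d : D, x = incl C D (a ⊗ₜ d)}).topologicalClosure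

end MinTensor

/-! ### Distances between subspaces -/

section Distances

variable {X : Type*} [NormedAddCommGroup X] [NormedSpace ℂ X]

/-- The closed unit ball of a subspace. -/
def unitBall (A : Submodule ℂ X) : Set X := {x | x ∈ A ∧ ‖x‖ ≤ 1}

/-- The Kadison–Kastler distance: the Hausdorff distance between the closed unit balls. -/
def dKK (A B : Submodule ℂ X) : ℝ :=
  max (⨆ x : unitBall A, Metric.infDist (x : X) (unitBall B))
    (⨆ z : unitBall B, Metric.infDist (z : X) (unitBall A))

/-- The near inclusion `A ⊆_γ B`. -/
def NearIncl (γ : ℝ) (A B : Submodule ℂ X) : Prop :=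
  ∀ x ∈ unitBall A, ∃ y ∈ B, ‖x - y‖ ≤ γ

/-- The Christensen distance. -/
def dZero (A B : Submodule ℂ X) : ℝ :=
  sInf {γ : ℝ | 0 < γ ∧ NearIncl γ A B ∧ NearIncl γ B A}

end Distances

end

/-! Since `D` is commutative, a tensor `z` is a continuous `C`-valued function `x ↦ evalAt x z` on
the characters of the unitization of `D`, vanishing at infinity, and the minimal norm is the sup
norm of this function (`norm_evalAt_le` and `minNorm_le_of_evalAt`).

From tensor products to factors: multiply `a ∈ A` by a function `d` with `d(x) = 1` and `‖d‖ ≤ 1`,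
approximate `a ⊗ d`, and evaluate at `x`. Evaluation is contractive and keeps values in `B` because
`B` is closed (`boundedNearIncl_of_subTensor`).

From factors to tensor products: approximate the values of `z` at finitely many points and glue with
a partition of unity. Convexity of balls preserves both the error and the norm of the approximant,
up to `ε` in the error (`exists_approx`, `boundedNearIncl_subTensor`).

Both distances are read off from `BoundedNearIncl γ R`: `R = 1` gives `dKK`, and `R = 1 + γ`, which
is automatic, gives `dZero`. The loss `ε` disappears in the supremum or infimum. -/

noncomputable section

/-! ### Norming states via the unitization -/

namespace CStarAlgebra

section Unital

variable {E : Type*} [CStarAlgebra E] [PartialOrder E] [StarOrderedRing E]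

lemma norm_one_add_of_nonneg [Nontrivial E] {p : E} (hp : 0 ≤ p) : ‖1 + p‖ = 1 + ‖p‖ := by
  refine le_antisymm ((norm_add_le _ _).trans_eq (by simp)) ?_
  have h := spectrum.add_mem_add_iff (s := (1 : ℝ)) |>.mpr (norm_mem_spectrum_of_nonneg hp)
  have := spectrum.norm_le_norm_of_mem h
  rw [Real.norm_of_nonneg (by positivity)] at this
  simpa [add_comm] using this

/-- A functional of norm at most one with `f 1 = 1` is positive. -/
lemma apply_nonneg_of_norm_le_one {f : StrongDual ℂ E} (hf : ‖f‖ ≤ 1) (h1 : f 1 = 1) {p : E}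
    (hp : 0 ≤ p) : 0 ≤ f p := by
  have : Nontrivial E := ⟨1, 0, fun h ↦ by simp [h] at h1⟩
  -- Centring: the spectrum of `p` lies in `[0, 2m]`, so `q = p - m` has norm at most `m`.
  set m : ℝ := ‖p‖ / 2
  have hm : 0 ≤ m := by positivity
  set q : E := p - algebraMap ℝ E m
  have hq : IsSelfAdjoint q := (IsSelfAdjoint.of_nonneg hp).sub (.algebraMap _ (.all _))
  have hqm : ‖q‖ ≤ m := by
    have h2 : q ≤ algebraMap ℝ E m := by
      rw [sub_le_iff_le_add, ← map_add, add_halves]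
      exact IsSelfAdjoint.le_algebraMap_norm_self
    have h3 : -algebraMap ℝ E m ≤ q := by simpa [q] using hp
    rcases norm_or_neg_norm_mem_spectrum hq with h | h
    · exact (le_algebraMap_iff_spectrum_le hq).mp h2 _ h
    · rw [← map_neg] at h3
      exact neg_le_neg_iff.mp ((algebraMap_le_iff_le_spectrum hq).mp h3 _ h)
  -- This is `‖f r‖² ≤ ‖r‖²` for `r = q + it`. The case `t = 0` bounds the real part; large `t`
  -- forces the imaginary part to vanish.
  have key (t : ℝ) : ((f p).re - m) ^ 2 + ((f p).im + t) ^ 2 ≤ m ^ 2 + t ^ 2 := by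
    set r : E := q + algebraMap ℂ E (t * Complex.I)
    have e : star r * r = q * q + algebraMap ℝ E (t ^ 2) := by
      have hc : star (algebraMap ℂ E (t * Complex.I)) = -algebraMap ℂ E (t * Complex.I) := by
        rw [← algebraMap_star_comm]; simp
      have hs : algebraMap ℂ E (t * Complex.I) * algebraMap ℂ E (t * Complex.I) =
          -algebraMap ℝ E (t ^ 2) := by
        rw [← map_mul, IsScalarTower.algebraMap_apply ℝ ℂ E, ← map_neg]
        congr 1
        simp only [Complex.coe_algebraMap]
        push_cast
        linear_combination (t : ℂ) ^ 2 * Complex.I_sq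
      rw [star_add, hq.star_eq, hc, add_mul, mul_add, mul_add, neg_mul, neg_mul, hs,
        Algebra.commutes]
      abel
    have hr : ‖r‖ ^ 2 ≤ m ^ 2 + t ^ 2 := by
      rw [sq ‖r‖, ← CStarRing.norm_star_mul_self, e]
      refine (norm_add_le _ _).trans (add_le_add ((norm_mul_le _ _).trans ?_) ?_)
      · rw [sq]; gcongr
      · exact (norm_algebraMap' E (t ^ 2)).le.trans (by simp)
    have hfr : ‖f r‖ ^ 2 ≤ m ^ 2 + t ^ 2 := by
      refine le_trans ?_ hr
      gcongr
      simpa using f.le_of_opNorm_le hf r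
    have hfr' : f r = f p - m + t * Complex.I := by
      simp only [r, q, map_add, map_sub, Algebra.algebraMap_eq_smul_one, map_smul, h1,
        smul_eq_mul, mul_one, ← Complex.coe_smul]
    rw [hfr', ← Complex.normSq_eq_norm_sq, Complex.normSq_apply] at hfr
    simpa [← sq] using hfr
  have h0 := key 0
  have him : (f p).im = 0 := by
    by_contra hne
    -- With this `t` the cross term `2 t (f p).im` is `2 m ^ 2`, which leaves `(f p).im ^ 2 + m ^ 2
    -- ≤ 0`.
    have h := key (m ^ 2 / (f p).im)
    have h5 : (f p).im * (m ^ 2 / (f p).im) = m ^ 2 := by field_simp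
    have h6 : 0 < (f p).im ^ 2 := by positivity
    nlinarith [sq_nonneg ((f p).re - m), sq_nonneg m]
  rw [him] at h0
  rw [Complex.le_def]
  refine ⟨?_, by simp [him]⟩
  simp only [Complex.zero_re]
  nlinarith [abs_le_of_sq_le_sq' (a := (f p).re - m) (b := m) (by linarith) hm]

end Unital

end CStarAlgebra

namespace MinTensor

/-- With `a = star c * c`, a Hahn–Banach functional norming `1 + a`, of norm `1 + ‖a‖`, must satisfy
both `f 1 = 1` and `f a = ‖a‖`. The first makes it positive; the second keeps its restriction to `C`
of norm one. -/
lemma exists_state_apply_eq_norm {C : Type*} [NonUnitalCStarAlgebra C] {c : C} (hc : c ≠ 0) :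
    ∃ φ ∈ stateSpace C, φ (star c * c) = ‖star c * c‖ := by
  let _ : PartialOrder (Unitization ℂ C) := CStarAlgebra.spectralOrder _
  let _ : StarOrderedRing (Unitization ℂ C) := CStarAlgebra.spectralOrderedRing _
  set a := star c * c
  have ha : a ≠ 0 := by simpa [a] using hc
  have hpos (b : C) : (0 : Unitization ℂ C) ≤ ((star b * b : C) : Unitization ℂ C) := by
    rw [Unitization.inr_mul, Unitization.inr_star]
    exact star_mul_self_nonneg _
  have hn (b : C) : ‖(b : Unitization ℂ C)‖ = ‖b‖ := Unitization.norm_inr b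
  have hsum := CStarAlgebra.norm_one_add_of_nonneg (hpos c)
  rw [hn] at hsum
  obtain ⟨f, hf, hfe⟩ := exists_dual_vector ℂ (1 + (a : Unitization ℂ C)) (by
    rw [hsum]
    positivity)
  have h1 : ‖f 1‖ ≤ 1 := by simpa using f.le_of_opNorm_le hf.le 1
  have h2 : ‖f a‖ ≤ ‖a‖ := by simpa [hn] using f.le_of_opNorm_le hf.le (a : Unitization ℂ C)
  have h1' := (Complex.re_le_norm _).trans h1
  have h2' := (Complex.re_le_norm _).trans h2
  rw [hsum, map_add] at hfe
  have hre := congrArg Complex.re hfe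
  simp at hre
  have eq_of {z : ℂ} {r : ℝ} (hz : ‖z‖ ≤ r) (hr : r ≤ z.re) : z = r := by
    have h3 : z.re = r := le_antisymm ((Complex.re_le_norm z).trans hz) hr
    have h4 : ‖z‖ ^ 2 ≤ r ^ 2 := by gcongr
    rw [← Complex.normSq_eq_norm_sq, Complex.normSq_apply, h3] at h4
    exact Complex.ext h3 (by simpa using (by nlinarith : z.im ^ 2 ≤ 0).antisymm (sq_nonneg _))
  have e1 : f 1 = 1 := by
    exact_mod_cast eq_of h1 (by linarith)
  have e2 : f a = ‖a‖ := eq_of h2 (by linarith)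
  let φ : StrongDual ℂ C := (f.toLinearMap ∘ₗ Unitization.inrHom ℂ ℂ C).mkContinuous 1
    fun b ↦ by simpa [hn] using f.le_of_opNorm_le hf.le (b : Unitization ℂ C)
  have hφ (b : C) : φ b = f b := rfl
  refine ⟨φ, ⟨fun b ↦ ?_, le_antisymm (LinearMap.mkContinuous_norm_le _ zero_le_one _) ?_⟩, e2⟩
  · exact CStarAlgebra.apply_nonneg_of_norm_le_one hf.le e1 (hpos b)
  · have h := φ.le_opNorm a
    rw [hφ, e2] at h
    have ha' : 0 < ‖a‖ := norm_pos_iff.mpr ha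
    simp only [Complex.norm_real, norm_norm] at h
    nlinarith

end MinTensor

/-! ### Gelfand theory of `D` as functions vanishing at infinity -/

namespace MinTensor

open WeakDual

/-- The spectrum of the unitization: the one-point compactification of the spectrum of `D`. -/
abbrev Points (D : Type*) [NonUnitalCommCStarAlgebra D] : Type _ :=
  characterSpace ℂ (Unitization ℂ D)

section Points

variable {D : Type*} [NonUnitalCommCStarAlgebra D]

variable (D) in
/-- The point at infinity: the character of the unitization that vanishes on `D`. -/
def infinity : Points D := CharacterSpace.equivAlgHom.symm (Unitization.fstHom ℂ D)

@[simp] lemma infinity_apply (u : Unitization ℂ D) : infinity D u = u.fst := rfl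

/-- Gelfand duality for the unitization yields a preimage; its scalar part is its value at infinity,
so the preimage lies in `D`. -/
lemma exists_apply_eq (r : C(Points D, ℂ)) (hr : r (infinity D) = 0) :
    ∃ d : D, (∀ x : Points D, x (d : Unitization ℂ D) = r x) ∧ ‖d‖ = ‖r‖ := by
  set u := (gelfandStarTransform (Unitization ℂ D)).symm r
  have hu : gelfandStarTransform _ u = r := StarAlgEquiv.apply_symm_apply _ r
  have hx (x : Points D) : x u = r x := congrArg (fun s : C(Points D, ℂ) ↦ s x) hu
  have h0 : u.fst = 0 := by rw [← hr, ← hx]; rfl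
  have hd : ((u.snd : D) : Unitization ℂ D) = u := Unitization.ext (by simp [h0]) (by simp)
  refine ⟨u.snd, fun x ↦ by rw [hd, hx], ?_⟩
  rw [← Unitization.norm_inr (𝕜 := ℂ), hd, ← hu]
  exact ((gelfandTransform_isometry (Unitization ℂ D)).norm_map_of_map_zero (map_zero _) u).symm

lemma points_ext {d e : D} (h : ∀ x : Points D, x (d : Unitization ℂ D) = x e) : d = e := by
  apply Unitization.inr_injective (R := ℂ)
  apply (gelfandStarTransform (Unitization ℂ D)).injective
  ext x
  exact h x

lemma points_star (x : Points D) (d : D) :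
    x ((star d : D) : Unitization ℂ D) = star (x d) := by
  rw [Unitization.inr_star, map_star]

lemma points_mul (x : Points D) (d e : D) :
    x ((d * e : D) : Unitization ℂ D) = x d * x e := by
  rw [Unitization.inr_mul, map_mul]

lemma exists_eq_star_mul_self {k : D} (hk : ∀ x : Points D, 0 ≤ x (k : Unitization ℂ D)) :
    ∃ b : D, k = star b * b := by
  let r : C(Points D, ℂ) := ⟨fun x ↦ (√(x (k : Unitization ℂ D)).re : ℂ), by
    have : Continuous fun x : Points D ↦ x (k : Unitization ℂ D) :=
      map_continuous (gelfandStarTransform _ (k : Unitization ℂ D))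
    exact Complex.continuous_ofReal.comp (Real.continuous_sqrt.comp (Complex.continuous_re.comp this))⟩
  obtain ⟨b, hb, -⟩ := exists_apply_eq r (by simp [r])
  refine ⟨b, points_ext fun x ↦ ?_⟩
  obtain ⟨h1, h2⟩ := Complex.le_def.mp (hk x)
  rw [points_mul, points_star, hb]
  simp only [r, ContinuousMap.coe_mk, Complex.star_def, Complex.conj_ofReal]
  rw [← Complex.ofReal_mul, Real.mul_self_sqrt h1]
  exact Complex.ext (by simp) (by simpa using h2.symm)

/-- A Urysohn function separating `x` from infinity. -/
lemma exists_peak {x : Points D} (hx : x ≠ infinity D) :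
    ∃ d : D, x (d : Unitization ℂ D) = 1 ∧ ‖d‖ ≤ 1 := by
  obtain ⟨f, hf0, hf1, hf⟩ := exists_continuous_zero_one_of_isClosed
    (isClosed_singleton (x := infinity D)) (isClosed_singleton (x := x)) (by simpa using hx.symm)
  obtain ⟨d, hd, hn⟩ := exists_apply_eq ((Complex.ofRealCLM : C(ℝ, ℂ)).comp f)
    (by simpa using hf0 rfl)
  refine ⟨d, by simpa [hd] using hf1 rfl, hn.trans_le ?_⟩
  refine (ContinuousMap.norm_le _ zero_le_one).mpr fun y ↦ ?_
  simpa [abs_of_nonneg (hf y).1] using (hf y).2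

lemma exists_ne_infinity [Nontrivial D] : ∃ x : Points D, x ≠ infinity D := by
  obtain ⟨d, hd⟩ := exists_ne (0 : D)
  by_contra! h
  exact hd (points_ext fun x ↦ by simp [h x])

/-- Evaluation at a point, as a functional on `D`. -/
def pointFunctional (x : Points D) : StrongDual ℂ D :=
  ((CharacterSpace.toAlgHom x).toLinearMap ∘ₗ Unitization.inrHom ℂ ℂ D).mkContinuous 1 fun d ↦ by
    have h := spectrum.norm_le_norm_of_mem (CharacterSpace.apply_mem_spectrum x (d : Unitization ℂ D))
    rwa [Unitization.norm_inr, ← one_mul ‖d‖] at h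

@[simp] lemma pointFunctional_apply (x : Points D) (d : D) :
    pointFunctional x d = x (d : Unitization ℂ D) := rfl

lemma pointFunctional_mem_stateSpace {x : Points D} (hx : x ≠ infinity D) :
    pointFunctional x ∈ stateSpace D := by
  refine ⟨fun d ↦ ?_, le_antisymm (LinearMap.mkContinuous_norm_le _ zero_le_one _) ?_⟩
  · rw [pointFunctional_apply, points_mul, points_star]
    exact star_mul_self_nonneg _
  · obtain ⟨d, hd, hn⟩ := exists_peak hx
    have h := (pointFunctional x).le_opNorm_of_le hn
    simpa [hd] using h

end Points

/-! ### The minimal norm as a sup norm -/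

section Evaluation

variable {C D : Type*} [NonUnitalCStarAlgebra C] [NonUnitalCommCStarAlgebra D]

/-- Evaluation at a point on the algebraic tensor product, `c ⊗ d ↦ d(x) c`. -/
def evalAt (x : Points D) : C ⊗[ℂ] D →ₗ[ℂ] C :=
  (TensorProduct.rid ℂ C).toLinearMap ∘ₗ
    TensorProduct.map LinearMap.id (pointFunctional x).toLinearMap

@[simp] lemma evalAt_tmul (x : Points D) (c : C) (d : D) :
    evalAt x (c ⊗ₜ[ℂ] d) = x (d : Unitization ℂ D) • c := by
  simp [evalAt]

lemma evalAt_star (x : Points D) (z : C ⊗[ℂ] D) : evalAt x (star z) = star (evalAt x z) := by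
  induction z with
  | zero => simp
  | tmul c d => rw [TensorProduct.star_tmul, evalAt_tmul, evalAt_tmul, points_star, star_smul]
  | add u v hu hv => simp [hu, hv]

lemma evalAt_mul (x : Points D) (z w : C ⊗[ℂ] D) :
    evalAt x (z * w) = evalAt x z * evalAt x w := by
  induction z with
  | zero => simp
  | add u v hu hv => simp [add_mul, hu, hv]
  | tmul c d =>
    induction w with
    | zero => simp
    | add u v hu hv => simp [mul_add, hu, hv]
    | tmul c' d' =>
      simp only [Algebra.TensorProduct.tmul_mul_tmul, evalAt_tmul, points_mul]
      rw [smul_mul_smul_comm]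

lemma evalAt_infinity (z : C ⊗[ℂ] D) : evalAt (infinity D) z = 0 := by
  induction z with
  | zero => simp
  | tmul c d => simp
  | add u v hu hv => simp [hu, hv]

lemma tensorFunctional_pointFunctional (φ : StrongDual ℂ C) (x : Points D) (z : C ⊗[ℂ] D) :
    tensorFunctional φ (pointFunctional x) z = φ (evalAt x z) := by
  induction z with
  | zero => simp
  | tmul c d => simp [mul_comm]
  | add u v hu hv => simp [hu, hv]

lemma continuous_evalAt (z : C ⊗[ℂ] D) : Continuous fun x : Points D ↦ evalAt x z := by
  induction z with
  | zero => simp [continuous_const]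
  | tmul c d =>
    have : Continuous fun x : Points D ↦ x (d : Unitization ℂ D) :=
      map_continuous (gelfandStarTransform _ (d : Unitization ℂ D))
    simp only [evalAt_tmul]
    exact this.smul continuous_const
  | add u v hu hv => simp only [map_add]; fun_prop

/-- Put `c = evalAt x z` and test with `w = star c ⊗ d`, where `d(x) = 1`; `star c` stands in for a
unit. Under the product of evaluation at `x` with a state norming `(c * star c) ^ 2`, the defining
inequality becomes `‖c‖ ^ 2 ≤ minNorm z * ‖c‖`. -/
lemma norm_evalAt_le (x : Points D) (z : C ⊗[ℂ] D) : ‖evalAt x z‖ ≤ minNorm z := by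
  by_cases hx : x = infinity D
  · simpa [hx, evalAt_infinity] using minNorm_nonneg z
  set c := evalAt x z
  by_cases hc : star c = 0
  · simpa [star_eq_zero.mp hc] using minNorm_nonneg z
  obtain ⟨d, hd, -⟩ := exists_peak hx
  obtain ⟨φ, hφ, h⟩ := exists_state_apply_eq_norm (c := star (star c) * star c) (by simpa using hc)
  have key := sqrt_le_minNorm_mul hφ (pointFunctional_mem_stateSpace hx) z (star c ⊗ₜ[ℂ] d)
  have hz : evalAt x z = c := rfl
  simp only [tensorFunctional_pointFunctional, evalAt_mul, evalAt_star, evalAt_tmul, hd, one_smul,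
    hz, star_star] at h key
  rw [h] at key
  have h2 : (φ (c * star c)).re ≤ ‖c‖ ^ 2 := by
    refine (Complex.re_le_norm _).trans ((φ.le_opNorm _).trans_eq ?_)
    rw [hφ.2, one_mul, CStarRing.norm_self_mul_star, sq]
  rw [CStarRing.norm_star_mul_self, CStarRing.norm_self_mul_star, Complex.ofReal_re,
    Real.sqrt_mul_self (by positivity)] at key
  have hpos : 0 < ‖c‖ := norm_pos_iff.mpr fun h ↦ hc (by simp [h])
  have h3 : ‖c‖ * ‖c‖ ≤ minNorm z * ‖c‖ := key.trans
    (mul_le_mul_of_nonneg_left (Real.sqrt_le_iff.mpr ⟨hpos.le, h2⟩) (minNorm_nonneg z))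
  exact le_of_mul_le_mul_right h3 hpos

/-- The slice map `c ⊗ d ↦ φ c • d`. -/
def slice (φ : StrongDual ℂ C) : C ⊗[ℂ] D →ₗ[ℂ] D :=
  (TensorProduct.lid ℂ D).toLinearMap ∘ₗ TensorProduct.map φ.toLinearMap LinearMap.id

@[simp] lemma slice_tmul (φ : StrongDual ℂ C) (c : C) (d : D) :
    slice φ (c ⊗ₜ[ℂ] d) = φ c • d := by
  simp [slice]

lemma apply_slice (φ : StrongDual ℂ C) (ψ : StrongDual ℂ D) (z : C ⊗[ℂ] D) :
    ψ (slice φ z) = tensorFunctional φ ψ z := by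
  induction z with
  | zero => simp
  | tmul c d => simp
  | add u v hu hv => simp [hu, hv]

/-- Slicing `M ^ 2 • (star w * w) - star (z * w) * (z * w)` by `φ` gives an element of `D` that is
nonnegative at every point, hence of the form `star b * b`. Every state `ψ` is then nonnegative on
it, so characters control all states of `D`. -/
lemma minNorm_le_of_evalAt {z : C ⊗[ℂ] D} {M : ℝ} (hM : 0 ≤ M)
    (h : ∀ x : Points D, ‖evalAt x z‖ ≤ M) : minNorm z ≤ M := by
  refine minNorm_le hM fun φ hφ ψ hψ w ↦ ?_
  set u : C ⊗[ℂ] D := ((M ^ 2 : ℝ) : ℂ) • (star w * w) - star (z * w) * (z * w)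
  have hu (x : Points D) : 0 ≤ x ((slice φ u : D) : Unitization ℂ D) := by
    rw [← pointFunctional_apply, apply_slice, tensorFunctional_pointFunctional]
    simp only [u, map_sub, map_smul, evalAt_mul, evalAt_star, sub_nonneg]
    refine (left_mul_le hφ _ _).trans ?_
    rw [smul_eq_mul]
    refine mul_le_mul_of_nonneg_right ?_ (hφ.1 _)
    have := h x
    exact_mod_cast (by gcongr : ‖evalAt x z‖ ^ 2 ≤ M ^ 2)
  obtain ⟨b, hb⟩ := exists_eq_star_mul_self hu
  have h2 : 0 ≤ tensorFunctional φ ψ u := by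
    rw [← apply_slice, hb]
    exact hψ.1 b
  simp only [u, map_sub, map_smul, sub_nonneg, smul_eq_mul] at h2
  have h3 := (Complex.le_def.mp h2).1
  rw [Complex.re_ofReal_mul] at h3
  refine (Real.sqrt_le_sqrt h3).trans_eq ?_
  rw [Real.sqrt_mul (sq_nonneg _), Real.sqrt_sq hM]

end Evaluation

end MinTensor

/-! ### Distances through norm-controlled near inclusions -/

section Distances

variable {X : Type*} [NormedAddCommGroup X] [NormedSpace ℂ X]

/-- The near inclusion `A ⊆_γ B`, with approximants of norm at most `R`. -/
def BoundedNearIncl (γ R : ℝ) (A B : Submodule ℂ X) : Prop :=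
  ∀ x ∈ unitBall A, ∃ y ∈ B, ‖y‖ ≤ R ∧ ‖x - y‖ ≤ γ

lemma zero_mem_unitBall (A : Submodule ℂ X) : (0 : X) ∈ unitBall A := ⟨A.zero_mem, by simp⟩

lemma BoundedNearIncl.nonneg {γ R : ℝ} {A B : Submodule ℂ X} (h : BoundedNearIncl γ R A B) :
    0 ≤ γ ∧ 0 ≤ R := by
  obtain ⟨y, -, h1, h2⟩ := h 0 (zero_mem_unitBall A)
  exact ⟨(norm_nonneg _).trans h2, (norm_nonneg _).trans h1⟩

lemma nearIncl_iff {γ : ℝ} {A B : Submodule ℂ X} :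
    NearIncl γ A B ↔ BoundedNearIncl γ (1 + γ) A B := by
  refine forall₂_congr fun x hx ↦ exists_congr fun y ↦ and_congr_right fun _ ↦
    ⟨fun h ↦ ⟨?_, h⟩, And.right⟩
  calc ‖y‖ = ‖x - (x - y)‖ := by simp
    _ ≤ ‖x‖ + ‖x - y‖ := norm_sub_le _ _
    _ ≤ 1 + γ := add_le_add hx.2 h

/-- The `ε` is needed because the distance to a unit ball may fail to be attained. -/
lemma iSup_infDist_le_iff {γ : ℝ} {A B : Submodule ℂ X} :
    ⨆ x : unitBall A, Metric.infDist (x : X) (unitBall B) ≤ γ ↔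
      ∀ ε > 0, BoundedNearIncl (γ + ε) 1 A B := by
  have : Nonempty (unitBall A) := ⟨⟨0, zero_mem_unitBall A⟩⟩
  have hbdd : BddAbove (Set.range fun x : unitBall A ↦ Metric.infDist (x : X) (unitBall B)) := by
    refine ⟨1, ?_⟩
    rintro _ ⟨x, rfl⟩
    refine (Metric.infDist_le_dist_of_mem (zero_mem_unitBall B)).trans ?_
    simpa using x.2.2
  rw [ciSup_le_iff hbdd]
  constructor
  · intro h ε hε x hx
    obtain ⟨y, hy, hd⟩ := (Metric.infDist_lt_iff ⟨0, zero_mem_unitBall B⟩).mp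
      ((h ⟨x, hx⟩).trans_lt (lt_add_of_pos_right γ hε))
    exact ⟨y, hy.1, hy.2, by simpa [dist_eq_norm] using hd.le⟩
  · intro h x
    refine le_of_forall_pos_le_add fun ε hε ↦ ?_
    obtain ⟨y, hy, hR, hd⟩ := h ε hε x x.2
    have hyB : y ∈ unitBall B := ⟨hy, hR⟩
    refine (Metric.infDist_le_dist_of_mem hyB).trans ?_
    rwa [dist_eq_norm]

variable {Y : Type*} [NormedAddCommGroup Y] [NormedSpace ℂ Y]

lemma iSup_infDist_eq {A B : Submodule ℂ X} {A' B' : Submodule ℂ Y}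
    (up : ∀ γ R ε : ℝ, 0 < ε → BoundedNearIncl γ R A B → BoundedNearIncl (γ + ε) R A' B')
    (down : ∀ γ R : ℝ, BoundedNearIncl γ R A' B' → BoundedNearIncl γ R A B) :
    ⨆ x : unitBall A, Metric.infDist (x : X) (unitBall B) =
      ⨆ x : unitBall A', Metric.infDist (x : Y) (unitBall B') := by
  refine eq_of_forall_ge_iff fun γ ↦ ?_
  rw [iSup_infDist_le_iff, iSup_infDist_le_iff]
  refine ⟨fun h ε hε ↦ ?_, fun h ε hε ↦ down _ _ (h ε hε)⟩
  simpa [add_assoc] using up _ _ (ε / 2) (half_pos hε) (h (ε / 2) (half_pos hε))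

/-- Zero approximates the whole unit ball within `1`; nonemptiness keeps `sInf` from taking its
default value. -/
lemma one_mem_dZero (A B : Submodule ℂ X) :
    (1 : ℝ) ∈ {γ : ℝ | 0 < γ ∧ NearIncl γ A B ∧ NearIncl γ B A} :=
  ⟨one_pos, fun x hx ↦ ⟨0, B.zero_mem, by simpa using hx.2⟩,
    fun x hx ↦ ⟨0, A.zero_mem, by simpa using hx.2⟩⟩

lemma bddBelow_dZero (A B : Submodule ℂ X) :
    BddBelow {γ : ℝ | 0 < γ ∧ NearIncl γ A B ∧ NearIncl γ B A} := ⟨0, fun _ h ↦ h.1.le⟩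

lemma dZero_eq {A B : Submodule ℂ X} {A' B' : Submodule ℂ Y}
    (up : ∀ γ ε : ℝ, 0 < ε → NearIncl γ A B → NearIncl γ B A →
      NearIncl (γ + ε) A' B' ∧ NearIncl (γ + ε) B' A')
    (down : ∀ γ : ℝ, NearIncl γ A' B' → NearIncl γ B' A' → NearIncl γ A B ∧ NearIncl γ B A) :
    dZero A B = dZero A' B' := by
  refine le_antisymm (csInf_le_csInf (bddBelow_dZero A B) ⟨1, one_mem_dZero A' B'⟩
    fun γ h ↦ ⟨h.1, down γ h.2.1 h.2.2⟩) (le_csInf ⟨1, one_mem_dZero A B⟩ fun γ h ↦ ?_)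
  exact le_of_forall_pos_le_add fun ε hε ↦
    csInf_le (bddBelow_dZero A' B') ⟨add_pos h.1 hε, up γ ε hε h.2.1 h.2.2⟩

end Distances

/-! ### Transfer of near inclusions between factors and tensor products -/

namespace MinTensor

variable {C D : Type*} [NonUnitalCStarAlgebra C] [NonUnitalCommCStarAlgebra D]

lemma norm_incl (z : C ⊗[ℂ] D) : ‖incl C D z‖ = minNorm z :=
  UniformSpace.Completion.norm_coe _

/-- Evaluation at a point on the minimal tensor product. -/
def evalMin (x : Points D) : MinTensorProduct C D →L[ℂ] C :=
  ((evalAt x ∘ₗ (toAlgTensor C D).symm.toLinearMap).mkContinuous 1 fun z ↦ by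
    rw [one_mul]
    exact norm_evalAt_le x _).extend
    (UniformSpace.Completion.toComplL (𝕜 := ℂ) (E := AlgTensor C D))

lemma evalMin_incl (x : Points D) (z : C ⊗[ℂ] D) : evalMin x (incl C D z) = evalAt x z :=
  ContinuousLinearMap.extend_eq _ UniformSpace.Completion.denseRange_coe
    (UniformSpace.Completion.isUniformInducing_coe _) (toAlgTensor C D z)

lemma norm_evalMin_le (x : Points D) (u : MinTensorProduct C D) : ‖evalMin x u‖ ≤ ‖u‖ := by
  induction u using UniformSpace.Completion.induction_on with
  | hp => exact isClosed_le (by fun_prop) (by fun_prop)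
  | ih z =>
    have h := norm_evalAt_le x ((toAlgTensor C D).symm z)
    rwa [← norm_incl, ← evalMin_incl] at h

variable (D) in
/-- The algebraic tensor product `A ⊗ D` inside `C ⊗ D`. -/
def algSubTensor (A : NonUnitalStarSubalgebra ℂ C) : Submodule ℂ (C ⊗[ℂ] D) :=
  Submodule.span ℂ {z | ∃ a ∈ A, ∃ d : D, z = a ⊗ₜ d}

lemma subTensor_eq (A : NonUnitalStarSubalgebra ℂ C) :
    subTensor D A = ((algSubTensor D A).map (incl C D)).topologicalClosure := by
  rw [subTensor, algSubTensor, Submodule.map_span]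
  congr 2
  ext u
  simp only [Set.mem_image, Set.mem_ofPred_eq]
  constructor
  · rintro ⟨a, ha, d, rfl⟩
    exact ⟨_, ⟨a, ha, d, rfl⟩, rfl⟩
  · rintro ⟨_, ⟨a, ha, d, rfl⟩, rfl⟩
    exact ⟨a, ha, d, rfl⟩

lemma incl_mem_subTensor {A : NonUnitalStarSubalgebra ℂ C} {z : C ⊗[ℂ] D}
    (hz : z ∈ algSubTensor D A) : incl C D z ∈ subTensor D A := by
  rw [subTensor_eq]
  exact Submodule.le_topologicalClosure _ (Submodule.mem_map_of_mem hz)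

lemma tmul_mem_algSubTensor {A : NonUnitalStarSubalgebra ℂ C} {a : C} (ha : a ∈ A) (d : D) :
    a ⊗ₜ[ℂ] d ∈ algSubTensor D A :=
  Submodule.subset_span ⟨a, ha, d, rfl⟩

lemma evalAt_mem {A : NonUnitalStarSubalgebra ℂ C} {z : C ⊗[ℂ] D} (hz : z ∈ algSubTensor D A)
    (x : Points D) : evalAt x z ∈ toSubspace A := by
  suffices algSubTensor D A ≤ (toSubspace A).comap (evalAt x) from this hz
  refine Submodule.span_le.mpr ?_
  rintro _ ⟨a, ha, d, rfl⟩
  rw [SetLike.mem_coe, Submodule.mem_comap, evalAt_tmul]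
  exact Submodule.smul_mem _ _ ha

lemma evalMin_mem {A : NonUnitalStarSubalgebra ℂ C} (hA : IsClosed (toSubspace A : Set C))
    {u : MinTensorProduct C D} (hu : u ∈ subTensor D A) (x : Points D) :
    evalMin x u ∈ toSubspace A := by
  rw [subTensor_eq] at hu
  suffices ((algSubTensor D A).map (incl C D)).topologicalClosure ≤
      (toSubspace A).comap (evalMin x).toLinearMap from this hu
  refine Submodule.topologicalClosure_minimal _ ?_ (hA.preimage (evalMin x).continuous)
  rintro _ ⟨z, hz, rfl⟩
  rw [Submodule.mem_comap, ContinuousLinearMap.coe_coe, evalMin_incl]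
  exact evalAt_mem hz x

lemma minNorm_tmul_le (c : C) (d : D) : minNorm (c ⊗ₜ[ℂ] d) ≤ ‖c‖ * ‖d‖ := by
  refine minNorm_le_of_evalAt (by positivity) fun x ↦ ?_
  rw [evalAt_tmul, norm_smul, mul_comm]
  gcongr
  have h := (pointFunctional x).le_of_opNorm_le (LinearMap.mkContinuous_norm_le _ zero_le_one _) d
  simpa using h

/-- Near inclusions of minimal tensor products restrict to the first factors. -/
lemma boundedNearIncl_of_subTensor [Nontrivial D] {A B : NonUnitalStarSubalgebra ℂ C}
    (hB : IsClosed (toSubspace B : Set C)) {γ R : ℝ}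
    (h : BoundedNearIncl γ R (subTensor D A) (subTensor D B)) :
    BoundedNearIncl γ R (toSubspace A) (toSubspace B) := by
  rintro a ⟨ha, ha1⟩
  obtain ⟨x, hx⟩ := exists_ne_infinity (D := D)
  obtain ⟨d, hd, hd1⟩ := exists_peak hx
  obtain ⟨u, hu, huR, hγ⟩ := h (incl C D (a ⊗ₜ d))
    ⟨incl_mem_subTensor (tmul_mem_algSubTensor ha d), by
      rw [norm_incl]
      exact (minNorm_tmul_le a d).trans (mul_le_one₀ ha1 (norm_nonneg _) hd1)⟩
  refine ⟨evalMin x u, evalMin_mem hB hu x, (norm_evalMin_le x u).trans huR, ?_⟩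
  have e : a - evalMin x u = evalMin x (incl C D (a ⊗ₜ d) - u) := by
    rw [map_sub, evalMin_incl, evalAt_tmul, hd, one_smul]
  rw [e]
  exact (norm_evalMin_le x _).trans hγ

/-- The approximant is `∑ ρᵢ bᵢ`, with `ρ` a partition of unity subordinate to patches on which `z`
varies by less than `ε / 2` from its central value, and `bᵢ ∈ B` approximating that value. At each
point both estimates are convex combinations. -/
lemma exists_approx {A B : NonUnitalStarSubalgebra ℂ C} {γ R ε : ℝ} (hε : 0 < ε)
    (h : BoundedNearIncl γ R (toSubspace A) (toSubspace B)) {z : C ⊗[ℂ] D}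
    (hz : z ∈ algSubTensor D A) (hz1 : minNorm z ≤ 1) :
    ∃ g ∈ algSubTensor D B, minNorm g ≤ R ∧ minNorm (z - g) ≤ γ + ε := by
  obtain ⟨hγ, hR⟩ := h.nonneg
  let U (p : Points D) : Set (Points D) := {x | ‖evalAt x z - evalAt p z‖ < ε / 2}
  have hU (p : Points D) : IsOpen (U p) :=
    isOpen_lt (by have := continuous_evalAt z; fun_prop) continuous_const
  have hpU (p : Points D) : p ∈ U p := by simpa [U] using hε
  obtain ⟨t, -, ht⟩ := (isCompact_univ (X := Points D)).elim_nhds_subcover U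
    fun p _ ↦ (hU p).mem_nhds (hpU p)
  obtain ⟨ρ, hρ⟩ := PartitionOfUnity.exists_isSubordinate isClosed_univ (fun i : t ↦ U i)
    (fun i ↦ hU i) (by simpa [Set.iUnion_subtype] using ht)
  have hsum (x : Points D) : ∑ i, ρ i x = 1 := by
    rw [← finsum_eq_sum_of_fintype, ρ.sum_eq_one (Set.mem_univ x)]
  have key (i : t) : ∃ b ∈ B, ∃ d : D, ‖b‖ ≤ R ∧ (∀ x : Points D,
      x (d : Unitization ℂ D) • b = (ρ i x : ℂ) • b) ∧ ∀ x ∈ U i, ‖evalAt x z - b‖ ≤ γ + ε := by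
    -- On a patch containing infinity, `ρ i` need not come from `D`. There `z` is smaller than `ε`,
    -- since it vanishes at infinity, so `b = 0` suffices.
    by_cases hi : infinity D ∈ U i
    · have hi' : ‖evalAt (i : Points D) z‖ < ε / 2 := by
        simpa [U, evalAt_infinity] using hi
      refine ⟨0, B.zero_mem, 0, by simpa using hR, by simp, fun x hx ↦ ?_⟩
      calc ‖evalAt x z - 0‖ = ‖(evalAt x z - evalAt (i : Points D) z) +
            evalAt (i : Points D) z‖ := by congr 1; abel
        _ ≤ ε / 2 + ε / 2 := (norm_add_le _ _).trans (add_le_add hx.le hi'.le)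
        _ ≤ γ + ε := by linarith
    · obtain ⟨b, hb, hbR, hbγ⟩ := h (evalAt (i : Points D) z)
        ⟨evalAt_mem hz _, (norm_evalAt_le _ z).trans hz1⟩
      -- Infinity lies outside the support of `ρ i`, so this weight is represented by an element of
      -- `D`.
      obtain ⟨d, hd, -⟩ := exists_apply_eq ((Complex.ofRealCLM : C(ℝ, ℂ)).comp (ρ i)) (by
        simpa using image_eq_zero_of_notMem_tsupport fun h' ↦ hi (hρ i h'))
      refine ⟨b, hb, d, hbR, fun x ↦ by rw [hd]; rfl, fun x hx ↦ ?_⟩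
      calc ‖evalAt x z - b‖ = ‖(evalAt (i : Points D) z - b) +
            (evalAt x z - evalAt (i : Points D) z)‖ := by congr 1; abel
        _ ≤ γ + ε / 2 := (norm_add_le _ _).trans (add_le_add hbγ hx.le)
        _ ≤ γ + ε := by linarith
  choose b hb d hbR hbd hbγ using key
  have hg (x : Points D) : evalAt x (∑ i, b i ⊗ₜ[ℂ] d i) = ∑ i, (ρ i x : ℂ) • b i := by
    rw [map_sum]
    exact Finset.sum_congr rfl fun i _ ↦ by rw [evalAt_tmul, hbd]
  refine ⟨∑ i, b i ⊗ₜ d i, Submodule.sum_mem _ fun i _ ↦ tmul_mem_algSubTensor (hb i) _,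
    minNorm_le_of_evalAt hR fun x ↦ ?_, minNorm_le_of_evalAt (by positivity) fun x ↦ ?_⟩
  · calc _ = ‖∑ i, (ρ i x : ℂ) • b i‖ := by rw [hg]
      _ ≤ ∑ i, ρ i x * R := norm_sum_le_of_le _ fun i _ ↦ by
        rw [norm_smul, Complex.norm_real, Real.norm_of_nonneg (ρ.nonneg i x)]
        exact mul_le_mul_of_nonneg_left (hbR i) (ρ.nonneg i x)
      _ = R := by rw [← Finset.sum_mul, hsum, one_mul]
  · calc _ = ‖∑ i, (ρ i x : ℂ) • (evalAt x z - b i)‖ := by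
          simp only [map_sub, hg, smul_sub, Finset.sum_sub_distrib, ← Finset.sum_smul]
          rw [← Complex.ofReal_sum, hsum, Complex.ofReal_one, one_smul]
      _ ≤ ∑ i, ρ i x * (γ + ε) := norm_sum_le_of_le _ fun i _ ↦ by
        rw [norm_smul, Complex.norm_real, Real.norm_of_nonneg (ρ.nonneg i x)]
        rcases eq_or_ne (ρ i x) 0 with h0 | h0
        · simp [h0]
        · exact mul_le_mul_of_nonneg_left
            (hbγ i x (hρ i (subset_tsupport _ h0))) (ρ.nonneg i x)
      _ = γ + ε := by rw [← Finset.sum_mul, hsum, one_mul]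

/-- Near inclusions extend to minimal tensor products with a commutative C⋆-algebra. -/
lemma boundedNearIncl_subTensor {A B : NonUnitalStarSubalgebra ℂ C} {γ R ε : ℝ} (hε : 0 < ε)
    (h : BoundedNearIncl γ R (toSubspace A) (toSubspace B)) :
    BoundedNearIncl (γ + ε) R (subTensor D A) (subTensor D B) := by
  rintro u ⟨hu, hu1⟩
  -- Error budget: `δ` for passing from `u` to an algebraic tensor `z`, `δ` for rescaling `z`, and
  -- `ε / 2` for `exists_approx`.
  set δ := ε / 4
  have hδ : 0 < δ := by positivity
  rw [subTensor_eq, ← SetLike.mem_coe, Submodule.topologicalClosure_coe,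
    Metric.mem_closure_iff] at hu
  obtain ⟨_, ⟨z, hz, rfl⟩, hzu⟩ := hu δ hδ
  rw [dist_eq_norm] at hzu
  have hz1 : minNorm z ≤ 1 + δ := by
    rw [← norm_incl]
    calc ‖incl C D z‖ = ‖u - (u - incl C D z)‖ := by simp
      _ ≤ 1 + δ := (norm_sub_le _ _).trans (add_le_add hu1 hzu.le)
  -- `z` may leave the unit ball by `δ`; scaling by `s` brings it back and moves it by at most `δ`.
  set s : ℝ := (1 + δ)⁻¹
  have hs : s * (1 + δ) = 1 := inv_mul_cancel₀ (by positivity)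
  have hs0 : 0 < s := by positivity
  have hs1 : s ≤ 1 := inv_le_one_of_one_le₀ (by linarith)
  have hnorm (r : ℝ) (hr : 0 ≤ r) : minNorm ((r : ℂ) • z) = r * minNorm z := by
    rw [← norm_incl, map_smul, norm_smul, norm_incl, Complex.norm_real, Real.norm_of_nonneg hr]
  obtain ⟨g, hg, hgR, hgγ⟩ := exists_approx (half_pos hε) h
    (Submodule.smul_mem _ (s : ℂ) hz) (by
      rw [hnorm s hs0.le, ← hs]
      gcongr)
  refine ⟨incl C D g, incl_mem_subTensor hg, (norm_incl g).trans_le hgR, ?_⟩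
  have h2 : ‖incl C D z - incl C D ((s : ℂ) • z)‖ ≤ δ := by
    have e : z - (s : ℂ) • z = ((1 - s : ℝ) : ℂ) • z := by
      push_cast; rw [sub_smul, one_smul]
    rw [← map_sub, e, norm_incl, hnorm _ (by linarith)]
    calc (1 - s) * minNorm z ≤ (1 - s) * (1 + δ) :=
          mul_le_mul_of_nonneg_left hz1 (by linarith)
      _ = δ := by linarith
  rw [← norm_incl, map_sub] at hgγ
  calc ‖u - incl C D g‖ = ‖(u - incl C D z) + (incl C D z - incl C D ((s : ℂ) • z)) +
        (incl C D ((s : ℂ) • z) - incl C D g)‖ := by congr 1; abel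
    _ ≤ δ + δ + (γ + ε / 2) := norm_add₃_le.trans (by gcongr)
    _ = γ + ε := by ring

end MinTensor

end

theorem mainTheorem9 {C D : Type*} [NonUnitalCStarAlgebra C] [NonUnitalCommCStarAlgebra D]
    [Nontrivial D] (A B : NonUnitalStarSubalgebra ℂ C)
    [FiniteDimensional ℂ A] [FiniteDimensional ℂ B] :
    dKK (MinTensor.toSubspace A) (MinTensor.toSubspace B) =
        dKK (MinTensor.subTensor D A) (MinTensor.subTensor D B) ∧
      dZero (MinTensor.toSubspace A) (MinTensor.toSubspace B) =
        dZero (MinTensor.subTensor D A) (MinTensor.subTensor D B) := by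
  -- Finite dimension enters through closedness, which keeps evaluations of limits inside the
  -- subalgebra.
  have isClosed (S : NonUnitalStarSubalgebra ℂ C) (hS : FiniteDimensional ℂ S) :
      IsClosed (MinTensor.toSubspace S : Set C) := by
    have : FiniteDimensional ℂ (MinTensor.toSubspace S) := hS
    exact Submodule.closed_of_finiteDimensional _
  have hA := isClosed A inferInstance
  have hB := isClosed B inferInstance
  have near_up {S T : NonUnitalStarSubalgebra ℂ C} {γ ε : ℝ} (hε : 0 < ε)
      (h : NearIncl γ (MinTensor.toSubspace S) (MinTensor.toSubspace T)) :
      NearIncl (γ + ε) (MinTensor.subTensor D S) (MinTensor.subTensor D T) := fun u hu ↦ by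
    obtain ⟨y, hy, -, hd⟩ := MinTensor.boundedNearIncl_subTensor hε (nearIncl_iff.mp h) u hu
    exact ⟨y, hy, hd⟩
  refine ⟨congrArg₂ max ?_ ?_, ?_⟩
  · exact iSup_infDist_eq (fun _ _ _ hε ↦ MinTensor.boundedNearIncl_subTensor hε)
      fun _ _ ↦ MinTensor.boundedNearIncl_of_subTensor hB
  · exact iSup_infDist_eq (fun _ _ _ hε ↦ MinTensor.boundedNearIncl_subTensor hε)
      fun _ _ ↦ MinTensor.boundedNearIncl_of_subTensor hA
  · refine dZero_eq (fun γ ε hε h1 h2 ↦ ⟨near_up hε h1, near_up hε h2⟩) fun γ h1 h2 ↦ ?_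
    -- Restriction to the factors loses no `ε`, so the same radius `1 + γ` serves on both sides.
    rw [nearIncl_iff] at h1 h2
    rw [nearIncl_iff, nearIncl_iff]
    exact ⟨MinTensor.boundedNearIncl_of_subTensor hB h1, MinTensor.boundedNearIncl_of_subTensor hA h2⟩
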